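/- Consider a two-armed stochastic bandit in which arm $i\in\{1,2\}$ gives i.i.d. rewards $X_{i,1},X_{i,2},\dots\sim\mathcal N(\mu_i,\sigma_i^2)$ with $\sigma_1,\sigma_2>0$, rewards of different arms being independent, and let $\mu_1>\mu_2$. Let $J(t)$ be the arm pulled in round $t$, let $N_1(t)$ be the number of pulls of arm 1 before round $t$, and let $\mathrm{Regret}(T)=\sum_{t=1}^{T}(\mu_1-\mu_{J(t)})$. Fix $\alpha\ge 0$ and $n_0=\max\{2,3-\lceil 2\alpha\rceil\}$. Thompson sampling with arm 2 known is the following policy. In the first $2n_0$ rounds each arm is pulled $n_0$ times. In each later round $t$, a value $\tilde\mu_1(t)$ is sampled, with fresh randomness, from the posterior distribution of the mean of arm 1 given the $N_1(t)$ rewards obtained from it so far, under the improper prior with density $(\sigma_1^2)^{-1-\alpha}$ with respect to $\mathrm d\mu_1\,\mathrm d(\sigma_1^2)$ on $\mathbb R\times(0,\infty)$; one puts $\tilde\mu_2(t)=\mu_2$ and pulls an arm $i$ that maximizes $\tilde\mu_i(t)$. (The reference prior is $\alpha=0$, the Jeffreys prior is $\alpha=1/2$.) Then there is a constant $\xi>0$,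 depending only on $\alpha,\mu_1,\mu_2,\sigma_1$ and not on $\sigma_2$, such that $$\liminf_{T\to\infty}\frac{\mathrm E[\mathrm{Regret}(T)]}{\log T}\ge\xi .$$ Consequently the asymptotic lower bound for this problem is not achieved when $\sigma_2$ is small: there is $s>0$, depending only on $\alpha,\mu_1,\mu_2,\sigma_1$, such that for all $\sigma_2\in(0,s)$ $$\liminf_{T\to\infty}\frac{\mathrm E[\mathrm{Regret}(T)]}{\log T}>\frac{\mu_1-\mu_2}{\tfrac12\log\bigl(1+(\mu_1-\mu_2)^2/\sigma_2^2\bigr)} .$$ If moreover $\alpha>0$, then there are $\xi'>0$ and $\eta>0$, depending only on $\alpha,\mu_1,\mu_2,\sigma_1$, such that $$\liminf_{T\to\infty}\frac{\mathrm E[\mathrm{Regret}(T)]}{T^{\eta}}\ge\xi' ,$$ i.e. the regret is polynomial. (The lower limits may be $+\infty$.) -/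

import Mathlib

open MeasureTheory ProbabilityTheory Filter Set

universe u

namespace NormalBandit

noncomputable section

/-! ### Stochastic bandits

Arms are indexed by `Fin K`, and rounds, as well as the successive rewards of an arm, are indexed
from `0`.  `J t ω` is the arm pulled in round `t`. -/

/-- The gap `Δ_i = μ* - μ_i`, where `μ*` is the maximum of the expectations. -/
def gap {K : ℕ} (μ : Fin K → ℝ) (i : Fin K) : ℝ := (⨆ j, μ j) - μ i

/-- The number of times that the arm `i` is pulled before round `t`. -/
def pullCount {K : ℕ} {Ω : Type u} (J : ℕ → Ω → Fin K) (i : Fin K) (t : ℕ) (ω : Ω) : ℕ :=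
  ((Finset.range t).filter (fun s => J s ω = i)).card

/-- The regret after `T` rounds. -/
def regret {K : ℕ} {Ω : Type u} (μ : Fin K → ℝ) (J : ℕ → Ω → Fin K) (T : ℕ) (ω : Ω) : ℝ :=
  ∑ t ∈ Finset.range T, gap μ (J t ω)

/-- The expected regret after `T` rounds. -/
def expectedRegret {K : ℕ} {Ω : Type u} [MeasurableSpace Ω] (P : Measure Ω) (μ : Fin K → ℝ)
    (J : ℕ → Ω → Fin K) (T : ℕ) : ℝ :=
  ∫ ω, regret μ J T ω ∂P

/-- `D_inf(Δ, σ²) = (1/2) log (1 + Δ² / σ²)`, with second argument the variance. -/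
def Dinf (Δ v : ℝ) : ℝ := (1 / 2) * Real.log (1 + Δ ^ 2 / v)

/-! ### Bayesian posterior of the mean of a normal distribution -/

/-- The (improper) prior with density `(σ²)^(-1-α)` with respect to `dμ d(σ²)` on the parameters
`(μ, σ²)` in `ℝ × (0, ∞)`. -/
def prior (α : ℝ) : Measure (ℝ × ℝ) :=
  (volume.prod (volume.restrict (Ioi 0))).withDensity
    (fun p => ENNReal.ofReal (p.2 ^ (-1 - α)))

/-- The likelihood of the parameters `p = (μ, σ²)` given the first `n` terms of `x`, regarded as an
i.i.d. sample of `N(μ, σ²)`. -/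
def likelihood (n : ℕ) (x : ℕ → ℝ) (p : ℝ × ℝ) : ENNReal :=
  ∏ k ∈ Finset.range n, gaussianPDF p.1 p.2.toNNReal (x k)

/-- Prior times likelihood: the unnormalized posterior of `(μ, σ²)`. -/
def unnormalizedPosterior (α : ℝ) (n : ℕ) (x : ℕ → ℝ) : Measure (ℝ × ℝ) :=
  (prior α).withDensity (likelihood n x)

/-- The posterior distribution of the mean `μ`: the normalized posterior of `(μ, σ²)`, pushed
forward to its first coordinate.  (For `n ≥ 2` with `n + 2α > 1` and a sample that is not constant,
the normalizing constant is finite and positive.) -/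
def posteriorMean (α : ℝ) (n : ℕ) (x : ℕ → ℝ) : Measure ℝ :=
  ((unnormalizedPosterior α n x univ)⁻¹ • unnormalizedPosterior α n x).map Prod.fst

/-! ### Thompson sampling with two arms, the second of which is known -/

/-- The number `n₀ = max {2, 3 - ⌈2α⌉}` of initial pulls of each arm. -/
def initialPulls (α : ℝ) : ℕ := (max 2 (3 - ⌈2 * α⌉)).toNat

/-- The information before round `t`: the table of the rewards, and the sampled means and pulled
arms of the earlier rounds. -/
abbrev past {Ω : Type u} (X : Fin 2 → ℕ → Ω → ℝ) (θ : Fin 2 → ℕ → Ω → ℝ) (J : ℕ → Ω → Fin 2)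
    (t : ℕ) : MeasurableSpace Ω :=
  MeasurableSpace.comap
    (fun ω => ((fun i n => X i n ω, fun (s : Fin t) => (fun i => θ i s ω, J s ω)) :
      (Fin 2 → ℕ → ℝ) × (Fin t → (Fin 2 → ℝ) × Fin 2)))
    inferInstance

/-- A realization, on the probability space `(Ω, P)`, of Thompson sampling for the two-armed normal
bandit with expectations `μ i` and standard deviations `σ i`, where the arm `0` has the prior
`(σ²)^(-1-α)` and the arm `1` is known.  `X i n` is the `n`-th reward from the arm `i`, `θ i t` is
the mean sampled for the arm `i` in round `t`, and `J t` is the arm pulled in round `t`. -/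
structure IsThompsonKnownArm {Ω : Type u} [MeasurableSpace Ω] (P : Measure Ω) (α : ℝ)
    (μ σ : Fin 2 → ℝ) (X : Fin 2 → ℕ → Ω → ℝ) (θ : Fin 2 → ℕ → Ω → ℝ)
    (J : ℕ → Ω → Fin 2) : Prop where
  measurable_reward : ∀ i n, Measurable (X i n)
  measurable_sample : ∀ i t, Measurable (θ i t)
  measurable_arm : ∀ t, Measurable (J t)
  /-- The rewards are independent. -/
  indep_reward : iIndepFun (fun (p : Fin 2 × ℕ) => X p.1 p.2) P
  /-- The rewards from the arm `i` have the distribution `N(μ_i, σ_i²)`. -/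
  law_reward : ∀ i n, P.map (X i n) = gaussianReal (μ i) (σ i ^ 2).toNNReal
  /-- Initialization, in any order: each arm is pulled `n₀` times in the first `2 n₀` rounds. -/
  initialization : ∀ i ω, pullCount J i (2 * initialPulls α) ω = initialPulls α
  /-- Afterwards the mean of the arm `0` is sampled from the posterior given the rewards received
  from this arm so far, with fresh randomness. -/
  sample_zero : ∀ t, 2 * initialPulls α ≤ t → ∀ B : Set ℝ, MeasurableSet B →
    P⟦θ 0 t ⁻¹' B | past X θ J t⟧ =ᵐ[P]
      fun ω => (posteriorMean α (pullCount J 0 t ω) (fun n => X 0 n ω)).real B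
  /-- The sample for the known arm is its true expectation. -/
  sample_one : ∀ t, 2 * initialPulls α ≤ t → ∀ ω, θ 1 t ω = μ 1
  /-- An arm with the largest sampled mean is pulled. -/
  arm_maximizes : ∀ t, 2 * initialPulls α ≤ t → ∀ ω i, θ i t ω ≤ θ (J t ω) t ω

end

end NormalBandit

/-! A few unlucky initial rewards can silence arm `0` for a very long time. Given `n` rewards, the
posterior of its mean has density proportional to `sumSq n x m ^ (-(n/2 + α))`. If the `n =
initialPulls α` initial rewards lie in an interval of length `ε` at distance at least 1 below `μ 1`,
the posterior gives `[μ 1, ∞)` mass at most `ε ^ d / d`, where `d = n - 1 + 2α`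
(`posteriorMean_Iio_ge`). As long as only arm `1` is pulled, this posterior does not change, so `k`
rounds pass without a pull of arm `0` with conditional probability at least `(1 - ε ^ d / d) ^ k`
(`measureReal_sampleBelow_inter_ge`).

Such a concentrated sample has probability at least of order `ε ^ (n - 1)`: the position of the
interval is free, so one power of `ε` is saved. Choosing `ε ^ d` of order `1 / k` shows that arm `0`
is silent for `k` rounds with probability at least of order `k ^ (-γ)`, where `γ = (n - 1) / (n - 1
+ 2α)` is `decayExponent α` (`exists_le_measureReal_sampleBelow`). Each silent round costs the gap,
so the regret dominates `∑ k ^ (-γ)`. Since `γ ≤ 1` this is at least logarithmic, and for `α > 0` we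
have `γ < 1` and it is polynomial. Only rewards of arm `0` enter, hence the constants do not see
`σ₂`; but the asymptotic bound tends to 0 with `σ₂`. -/

namespace NormalBandit

/-! ### The posterior of the mean -/

/-- The sum of the squared deviations of a sample from `m`. -/
noncomputable def sumSq (n : ℕ) (x : ℕ → ℝ) (m : ℝ) : ℝ := ∑ k ∈ Finset.range n, (x k - m) ^ 2

lemma continuous_sumSq (n : ℕ) (x : ℕ → ℝ) : Continuous (sumSq n x) := by
  unfold sumSq; fun_prop

/-- Two observations already give quadratic growth in `m` and, when they differ, a positive floor.
This is why `x 0 < x 1` serves below as the form of a nonconstant sample. -/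
lemma sumSq_lower {n : ℕ} (hn : 2 ≤ n) (x : ℕ → ℝ) (m : ℝ) :
    2 * (m - (x 0 + x 1) / 2) ^ 2 + (x 1 - x 0) ^ 2 / 2 ≤ sumSq n x m := by
  have h : ∑ k ∈ Finset.range 2, (x k - m) ^ 2 ≤ sumSq n x m :=
    Finset.sum_le_sum_of_subset_of_nonneg (by simpa using hn) fun _ _ _ => sq_nonneg _
  rw [Finset.sum_range_succ, Finset.sum_range_one] at h
  linarith [h, show 2 * (m - (x 0 + x 1) / 2) ^ 2 + (x 1 - x 0) ^ 2 / 2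
    = (x 0 - m) ^ 2 + (x 1 - m) ^ 2 by ring]

lemma sumSq_pos {n : ℕ} (hn : 2 ≤ n) {x : ℕ → ℝ} (hx : x 0 < x 1) (m : ℝ) :
    0 < sumSq n x m := by
  have := sumSq_lower hn x m
  have : 0 < (x 1 - x 0) ^ 2 := pow_pos (by linarith) 2
  nlinarith [sq_nonneg (m - (x 0 + x 1) / 2)]

lemma integrable_sumSq_rpow {n : ℕ} (hn : 2 ≤ n) {x : ℕ → ℝ} (hx : x 0 < x 1) {β : ℝ}
    (hβ : 1 / 2 < β) : Integrable fun m => sumSq n x m ^ (-β) := by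
  have hint : Integrable (fun m : ℝ => (1 + ‖m‖ ^ 2) ^ (-(2 * β) / 2)) :=
    integrable_rpow_neg_one_add_norm_sq (by simp; linarith)
  have hint' := (hint.comp_sub_right ((x 0 + x 1) / 2))
  have hd : 0 < (x 1 - x 0) ^ 2 := pow_pos (by linarith) 2
  -- A single constant below both coefficients in `sumSq_lower`, so that `sumSq` dominates `δ` times
  -- a translate of `1 + m ^ 2`.
  set δ := min 2 ((x 1 - x 0) ^ 2 / 2)
  have hδ : 0 < δ := lt_min (by norm_num) (by linarith)
  refine (hint'.const_mul (δ ^ (-β))).mono' ?_ (Eventually.of_forall fun m => ?_)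
  · exact ((continuous_sumSq n x).rpow_const
      fun m => Or.inl (sumSq_pos hn hx m).ne').aestronglyMeasurable
  · rw [Real.norm_of_nonneg (Real.rpow_nonneg (sumSq_pos hn hx m).le _)]
    rw [show -(2 * β) / 2 = -β by ring, ← Real.mul_rpow hδ.le (by positivity)]
    refine Real.rpow_le_rpow_of_nonpos (by positivity) ?_ (by linarith)
    have h1 : δ ≤ 2 := min_le_left _ _
    have h2 : δ ≤ (x 1 - x 0) ^ 2 / 2 := min_le_right _ _
    have := sumSq_lower hn x m
    rw [Real.norm_eq_abs, sq_abs]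
    nlinarith [sq_nonneg (m - (x 0 + x 1) / 2)]

/-- The integral of an unnormalized inverse gamma density. -/
lemma lintegral_inverseGamma {β r : ℝ} (hβ : 0 < β) (hr : 0 < r) :
    ∫⁻ v in Ioi (0 : ℝ), ENNReal.ofReal (v ^ (-1 - β) * Real.exp (-(r / v)))
      = ENNReal.ofReal ((1 / r) ^ β * Real.Gamma β) := by
  -- The substitution `t = 1 / v` turns the integral into a gamma integral.
  have h := integral_comp_rpow_Ioi (fun t : ℝ => t ^ (β - 1) * Real.exp (-(r * t)))
    (p := -1) (by norm_num)
  rw [Real.integral_rpow_mul_exp_neg_mul_Ioi hβ hr] at h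
  have hcongr : ∫ v in Ioi (0 : ℝ), v ^ (-1 - β) * Real.exp (-(r / v))
      = (1 / r) ^ β * Real.Gamma β := by
    rw [← h]
    refine setIntegral_congr_fun measurableSet_Ioi fun v hv => ?_
    have hv : 0 < v := hv
    simp only [smul_eq_mul, abs_neg, abs_one, one_mul]
    rw [← Real.rpow_mul hv.le, Real.rpow_neg_one, ← mul_assoc, ← Real.rpow_add hv,
      div_eq_mul_inv]
    congr 2
    ring
  rw [← hcongr, ofReal_integral_eq_lintegral_ofReal]
  -- Integrability comes for free: a nonintegrable function would have integral 0, but the value is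
  -- positive.
  · by_contra hc
    have := integral_undef hc
    rw [hcongr] at this
    have : 0 < (1 / r) ^ β * Real.Gamma β := by
      have := Real.Gamma_pos_of_pos hβ
      positivity
    linarith
  · exact (ae_restrict_mem measurableSet_Ioi).mono fun v (hv : 0 < v) => by
      show 0 ≤ _
      positivity

lemma measurable_likelihood (n : ℕ) (x : ℕ → ℝ) : Measurable (likelihood n x) := by
  unfold likelihood gaussianPDF gaussianPDFReal
  fun_prop

lemma likelihood_eq (n : ℕ) (x : ℕ → ℝ) (m : ℝ) {v : ℝ} (hv : 0 < v) :
    likelihood n x (m, v) = ENNReal.ofReal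
      ((2 * Real.pi) ^ (-(n : ℝ) / 2) * (v ^ (-(n : ℝ) / 2) *
        Real.exp (-(sumSq n x m / 2 / v)))) := by
  have hpi := Real.pi_pos
  have hsqrt (n : ℕ) : ((√(2 * Real.pi * v))⁻¹) ^ n
      = (2 * Real.pi) ^ (-(n : ℝ) / 2) * v ^ (-(n : ℝ) / 2) := by
    rw [← Real.mul_rpow (by positivity) hv.le, Real.sqrt_eq_rpow, ← Real.rpow_neg (by positivity),
      ← Real.rpow_natCast, ← Real.rpow_mul (by positivity)]
    congr 1; ring
  simp only [likelihood, gaussianPDF, gaussianPDFReal, Real.coe_toNNReal v hv.le]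
  rw [← ENNReal.ofReal_prod_of_nonneg (fun _ _ => by positivity), Finset.prod_mul_distrib,
    Finset.prod_const, Finset.card_range, hsqrt, ← Real.exp_sum, mul_assoc]
  congr 4
  rw [sumSq, Finset.sum_div, Finset.sum_div, ← Finset.sum_neg_distrib]
  refine Finset.sum_congr rfl fun k _ => ?_
  field_simp

/-- Up to a constant factor, the unnormalized posterior of the mean is a Student distribution. -/
lemma exists_unnormalizedPosterior_eq {α : ℝ} {n : ℕ} (hn : 2 ≤ n) (hα : 0 ≤ α) :
    ∃ C : ℝ, 0 < C ∧ ∀ x : ℕ → ℝ, x 0 < x 1 → ∀ B : Set ℝ, MeasurableSet B →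
      unnormalizedPosterior α n x (B ×ˢ univ)
        = ENNReal.ofReal (C * ∫ m in B, sumSq n x m ^ (-((n : ℝ) / 2 + α))) := by
  have hn' : (2 : ℝ) ≤ n := by exact_mod_cast hn
  set β : ℝ := (n : ℝ) / 2 + α with hβdef
  have hβ : 1 / 2 < β := by linarith
  have hβ0 : 0 < β := by linarith
  have hpi := Real.pi_pos
  have hG := Real.Gamma_pos_of_pos hβ0
  -- The power of `2π` comes from the Gaussian densities, the rest from integrating out the variance
  -- with `r = sumSq n x m / 2`. The constant is free of `x` and `B`, so it cancels on normalizing.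
  refine ⟨(2 * Real.pi) ^ (-(n : ℝ) / 2) * (2 ^ β * Real.Gamma β), by positivity,
    fun x hx B hB => ?_⟩
  have hmeas : Measurable fun p : ℝ × ℝ => ENNReal.ofReal (p.2 ^ (-1 - α)) := by fun_prop
  rw [unnormalizedPosterior, prior, ← withDensity_mul _ hmeas (measurable_likelihood n x),
    withDensity_apply _ (hB.prod .univ), ← Measure.prod_restrict, Measure.restrict_univ,
    lintegral_prod _ ((hmeas.mul (measurable_likelihood n x)).aemeasurable),
    ← integral_const_mul, ofReal_integral_eq_lintegral_ofReal]
  · refine lintegral_congr fun m => ?_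
    have hQ := sumSq_pos hn hx m
    have : ∀ v ∈ Ioi (0 : ℝ),
        ((fun p : ℝ × ℝ => ENNReal.ofReal (p.2 ^ (-1 - α))) * likelihood n x) (m, v)
        = ENNReal.ofReal ((2 * Real.pi) ^ (-(n : ℝ) / 2)) *
          ENNReal.ofReal (v ^ (-1 - β) * Real.exp (-(sumSq n x m / 2 / v))) := by
      intro v hv
      have hv : 0 < v := hv
      rw [Pi.mul_apply, likelihood_eq n x m hv, ← ENNReal.ofReal_mul (by positivity),
        ← ENNReal.ofReal_mul (by positivity)]
      congr 1
      rw [show -1 - β = (-1 - α) + (-(n : ℝ) / 2) by rw [hβdef]; ring, Real.rpow_add hv]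
      ring
    rw [setLIntegral_congr_fun measurableSet_Ioi this, lintegral_const_mul _ (by fun_prop),
      lintegral_inverseGamma hβ0 (by positivity), ← ENNReal.ofReal_mul (by positivity)]
    congr 1
    rw [show 1 / (sumSq n x m / 2) = 2 * (sumSq n x m)⁻¹ by field_simp,
      Real.mul_rpow (x := 2) (y := (sumSq n x m)⁻¹) (by norm_num) (by positivity),
      Real.inv_rpow hQ.le, Real.rpow_neg hQ.le]
    ring
  · exact ((integrable_sumSq_rpow hn hx hβ).const_mul _).integrableOn
  · refine Eventually.of_forall fun m => ?_
    have hQ := sumSq_pos hn hx m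
    show 0 ≤ _
    positivity

/-! ### Posterior tail against total mass for a concentrated sample. -/

lemma integral_sumSq_rpow_Ioi_le {n : ℕ} (hn : 2 ≤ n) {x : ℕ → ℝ} (hx : x 0 < x 1) {β y : ℝ}
    (hβ : 1 / 2 < β) (hy : ∀ k < n, x k ≤ y - 1) :
    ∫ m in Ici y, sumSq n x m ^ (-β) ≤ (n : ℝ) ^ (-β) / (2 * β - 1) := by
  have hn0 : (0 : ℝ) < n := by positivity
  have htail : ∫ m in Ioi y, (m + (1 - y)) ^ (-(2 * β)) = 1 / (2 * β - 1) := by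
    have h := (measurePreserving_add_right (volume : Measure ℝ) (1 - y)).setIntegral_preimage_emb
      (measurableEmbedding_addRight _) (fun t => t ^ (-(2 * β))) (Ioi 1)
    rw [show (fun m : ℝ => m + (1 - y)) ⁻¹' Ioi 1 = Ioi y by
      ext m; simp only [mem_preimage, mem_Ioi]; constructor <;> intro <;> linarith] at h
    rw [h, integral_Ioi_rpow_of_lt (by linarith) one_pos, Real.one_rpow, ← neg_div_neg_eq]
    congr 1 <;> ring
  have htail_int : IntegrableOn (fun m : ℝ => (m + (1 - y)) ^ (-(2 * β))) (Ioi y) := by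
    by_contra hc
    have := integral_undef hc
    rw [htail] at this
    have : 0 < 1 / (2 * β - 1) := by apply one_div_pos.2; linarith
    linarith
  calc ∫ m in Ici y, sumSq n x m ^ (-β) = ∫ m in Ioi y, sumSq n x m ^ (-β) :=
        integral_Ici_eq_integral_Ioi
    _ ≤ ∫ m in Ioi y, (n : ℝ) ^ (-β) * (m + (1 - y)) ^ (-(2 * β)) := by
        refine setIntegral_mono_on (integrable_sumSq_rpow hn hx hβ).integrableOn
          (htail_int.const_mul _) measurableSet_Ioi fun m (hm : y < m) => ?_
        have hm' : 0 < m + (1 - y) := by linarith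
        rw [show -(2 * β) = 2 * -β by ring, Real.rpow_mul hm'.le, ← Real.mul_rpow hn0.le
          (by positivity)]
        refine Real.rpow_le_rpow_of_nonpos (by positivity) ?_ (by linarith)
        rw [sumSq, ← nsmul_eq_mul]
        conv_lhs => rw [← Finset.card_range n]
        refine Finset.card_nsmul_le_sum _ _ _ fun k hk => ?_
        have := hy k (Finset.mem_range.1 hk)
        rw [show (x k - m) ^ 2 = (m - x k) ^ (2 : ℝ) by norm_cast; ring]
        exact Real.rpow_le_rpow hm'.le (by linarith) (by norm_num)
    _ = (n : ℝ) ^ (-β) / (2 * β - 1) := by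
        rw [integral_const_mul, htail]; ring

/-- For `m` in the interval holding the sample all deviations are at most `ε`, so the integrand is
at least `(n * ε ^ 2) ^ (-β)` on a set of length `ε`. The factor `n ^ (-β)` matches the one in the
tail bound. -/
lemma le_integral_sumSq_rpow {n : ℕ} (hn : 2 ≤ n) {x : ℕ → ℝ} (hx : x 0 < x 1) {β b ε : ℝ}
    (hβ : 1 / 2 < β) (hε : 0 < ε) (hb : ∀ k < n, x k ∈ Icc b (b + ε)) :
    (n : ℝ) ^ (-β) * ε ^ (-(2 * β - 1)) ≤ ∫ m, sumSq n x m ^ (-β) := by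
  have hn0 : (0 : ℝ) < n := by positivity
  have hint := integrable_sumSq_rpow hn hx hβ
  calc (n : ℝ) ^ (-β) * ε ^ (-(2 * β - 1))
      = ∫ m in Icc b (b + ε), (n * ε ^ 2) ^ (-β) := by
        rw [setIntegral_const, smul_eq_mul, measureReal_def, Real.volume_Icc,
          ENNReal.toReal_ofReal (by linarith), Real.mul_rpow hn0.le (by positivity),
          ← Real.rpow_natCast, ← Real.rpow_mul hε.le,
          show -(2 * β - 1) = 1 + ((2 : ℕ) : ℝ) * -β by push_cast; ring, Real.rpow_add hε,
          Real.rpow_one]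
        ring
    _ ≤ ∫ m in Icc b (b + ε), sumSq n x m ^ (-β) := by
        refine setIntegral_mono_on (integrableOn_const (by simp)) hint.integrableOn
          measurableSet_Icc fun m hm => ?_
        refine Real.rpow_le_rpow_of_nonpos (sumSq_pos hn hx m) ?_ (by linarith)
        rw [sumSq, ← nsmul_eq_mul]
        conv_rhs => rw [← Finset.card_range n]
        refine Finset.sum_le_card_nsmul _ _ _ fun k hk => ?_
        have := hb k (Finset.mem_range.1 hk)
        exact sq_le_sq' (by linarith [this.1, hm.2]) (by linarith [this.2, hm.1])
    _ ≤ ∫ m, sumSq n x m ^ (-β) :=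
        setIntegral_le_integral hint (Eventually.of_forall fun m =>
          Real.rpow_nonneg (sumSq_pos hn hx m).le _)

/-- If the sample is concentrated on a short interval far below `y`, then the posterior probability
of a mean that is at least `y` is small. -/
lemma posteriorMean_Iio_ge {α : ℝ} {n : ℕ} (hn : 2 ≤ n) (hα : 0 ≤ α) {x : ℕ → ℝ}
    (hx : x 0 < x 1) {b ε y : ℝ} (hε : 0 < ε) (hb : ∀ k < n, x k ∈ Icc b (b + ε))
    (hy : b + ε ≤ y - 1) :
    1 - ε ^ ((n : ℝ) - 1 + 2 * α) / ((n : ℝ) - 1 + 2 * α)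
      ≤ (posteriorMean α n x).real (Iio y) := by
  have hn' : (2 : ℝ) ≤ n := by exact_mod_cast hn
  obtain ⟨C, hC, hU⟩ := exists_unnormalizedPosterior_eq hn hα
  specialize hU x hx
  set β : ℝ := (n : ℝ) / 2 + α with hβdef
  have hβ : 1 / 2 < β := by linarith
  rw [show (n : ℝ) - 1 + 2 * α = 2 * β - 1 by rw [hβdef]; ring]
  have hd : 0 < 2 * β - 1 := by linarith
  have hint := integrable_sumSq_rpow hn hx hβ
  have hnn : ∀ m, 0 ≤ sumSq n x m ^ (-β) := fun m => Real.rpow_nonneg (sumSq_pos hn hx m).le _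
  have h1 := integral_sumSq_rpow_Ioi_le hn hx hβ (y := y) fun k hk => (hb k hk).2.trans hy
  have h2 := le_integral_sumSq_rpow hn hx hβ hε hb
  have hsplit : ∫ m in Iio y, sumSq n x m ^ (-β)
      = (∫ m, sumSq n x m ^ (-β)) - ∫ m in Ici y, sumSq n x m ^ (-β) := by
    rw [← integral_add_compl measurableSet_Iio hint (s := Iio y), compl_Iio]; ring
  have htot := hU univ .univ
  rw [univ_prod_univ, Measure.restrict_univ] at htot
  set A := ∫ m in Ici y, sumSq n x m ^ (-β)
  set D := ∫ m, sumSq n x m ^ (-β)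
  have hnβ : 0 < (n : ℝ) ^ (-β) := Real.rpow_pos_of_pos (by linarith) _
  have hεβ : 0 < ε ^ (-(2 * β - 1)) := Real.rpow_pos_of_pos hε _
  have hD : 0 < D := lt_of_lt_of_le (by positivity) h2
  have hDA : 0 ≤ D - A := by
    rw [← hsplit]; exact integral_nonneg hnn
  have hq : (posteriorMean α n x).real (Iio y) = (D - A) / D := by
    rw [measureReal_def, posteriorMean, Measure.map_apply measurable_fst measurableSet_Iio,
      ← prod_univ, Measure.smul_apply, smul_eq_mul, hU _ measurableSet_Iio, htot, hsplit,
      ENNReal.toReal_mul, ENNReal.toReal_inv, ENNReal.toReal_ofReal (by positivity),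
      ENNReal.toReal_ofReal (by positivity)]
    field_simp
  rw [hq, sub_div, div_self hD.ne', sub_le_sub_iff_left, div_le_iff₀ hD]
  calc A ≤ (n : ℝ) ^ (-β) / (2 * β - 1) := h1
    _ = ε ^ (2 * β - 1) / (2 * β - 1) * ((n : ℝ) ^ (-β) * ε ^ (-(2 * β - 1))) := by
        rw [Real.rpow_neg hε.le]
        have := Real.rpow_pos_of_pos hε (2 * β - 1)
        field_simp
    _ ≤ _ := by
        refine mul_le_mul_of_nonneg_left h2 ?_
        have := Real.rpow_pos_of_pos hε (2 * β - 1)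
        positivity

end NormalBandit

namespace NormalBandit

variable {Ω : Type u} {X θ : Fin 2 → ℕ → Ω → ℝ} {J : ℕ → Ω → Fin 2}

lemma gap_nonneg (μ : Fin 2 → ℝ) (i : Fin 2) : 0 ≤ gap μ i :=
  sub_nonneg.2 (le_ciSup (Set.finite_range μ).bddAbove i)

/-! ### Rounds in which the known arm is pulled -/

/-- The event that in each of the rounds `t₀, …, t₀ + k - 1` the mean sampled for the arm `0` is
below `y`. -/
def sampleBelow (θ : Fin 2 → ℕ → Ω → ℝ) (y : ℝ) (t₀ k : ℕ) : Set Ω :=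
  ⋂ s ∈ Finset.range k, θ 0 (t₀ + s) ⁻¹' Iio y

lemma sampleBelow_succ (θ : Fin 2 → ℕ → Ω → ℝ) (y : ℝ) (t₀ k : ℕ) :
    sampleBelow θ y t₀ (k + 1) = sampleBelow θ y t₀ k ∩ θ 0 (t₀ + k) ⁻¹' Iio y := by
  simp only [sampleBelow, Finset.range_add_one, Finset.set_biInter_insert]
  exact inter_comm _ _

/-- `past` contains the whole reward table, unobserved rewards included, so an event about rewards
is measurable with respect to it at every `t`. -/
lemma measurable_reward_past (i : Fin 2) (n t : ℕ) :
    Measurable[past X θ J t] (X i n) :=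
  have hf : Measurable fun p : (Fin 2 → ℕ → ℝ) × (Fin t → (Fin 2 → ℝ) × Fin 2) => p.1 i n := by
    fun_prop
  hf.comp (comap_measurable _)

lemma measurable_sample_past (i : Fin 2) {s t : ℕ} (hs : s < t) :
    Measurable[past X θ J t] (θ i s) :=
  have hf : Measurable fun p : (Fin 2 → ℕ → ℝ) × (Fin t → (Fin 2 → ℝ) × Fin 2) =>
      (p.2 ⟨s, hs⟩).1 i := by fun_prop
  hf.comp (comap_measurable _)

lemma measurableSet_sampleBelow_past (y : ℝ) (t₀ k : ℕ) :
    MeasurableSet[past X θ J (t₀ + k)] (sampleBelow θ y t₀ k) :=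
  Finset.measurableSet_biInter _ fun s hs =>
    measurable_sample_past 0 (by have := Finset.mem_range.1 hs; omega) measurableSet_Iio

namespace IsThompsonKnownArm

variable [mΩ : MeasurableSpace Ω] {P : Measure Ω} {α : ℝ} {μ σ : Fin 2 → ℝ}

lemma past_le (h : IsThompsonKnownArm P α μ σ X θ J) (t : ℕ) : past X θ J t ≤ mΩ := by
  refine Measurable.comap_le ?_
  refine Measurable.prodMk ?_ ?_
  · exact measurable_pi_lambda _ fun i => measurable_pi_lambda _ fun n => h.measurable_reward i n
  · exact measurable_pi_lambda _ fun s => Measurable.prodMk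
      (measurable_pi_lambda _ fun i => h.measurable_sample i s) (h.measurable_arm s)

lemma arm_eq_one (h : IsThompsonKnownArm P α μ σ X θ J)
    {t : ℕ} (ht : 2 * initialPulls α ≤ t) {ω : Ω} (hω : θ 0 t ω < μ 1) :
    J t ω = 1 := by
  have h1 := h.arm_maximizes t ht ω 1
  rw [h.sample_one t ht ω] at h1
  by_contra hc
  have h0 : J t ω = 0 := by omega
  rw [h0] at h1
  linarith

/-- The feedback that makes bad luck persist: while arm `0` is not pulled, its data and hence its
posterior stay frozen at the initial ones. -/
lemma pullCount_zero_eq (h : IsThompsonKnownArm P α μ σ X θ J)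
    {k : ℕ} {ω : Ω}
    (hω : ω ∈ sampleBelow θ (μ 1) (2 * initialPulls α) k) :
    pullCount J 0 (2 * initialPulls α + k) ω = initialPulls α := by
  induction k with
  | zero => exact h.initialization 0 ω
  | succ k ih =>
    rw [sampleBelow_succ] at hω
    rw [← add_assoc, pullCount, Finset.range_add_one, Finset.filter_insert, if_neg]
    · exact ih hω.1
    · rw [h.arm_eq_one (Nat.le_add_right _ _) hω.2]
      decide

/-- If on an event `G` that depends on the rewards only the posterior probability of a mean that is
below `μ 1` is at least `q`, then given `G` the arm `1` is pulled in the first `k` rounds after the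
initialization with probability at least `q ^ k`. -/
lemma measureReal_sampleBelow_inter_ge [IsProbabilityMeasure P]
    (h : IsThompsonKnownArm P α μ σ X θ J) {G : Set Ω}
    (hG : ∀ t, MeasurableSet[past X θ J t] G) {q : ℝ} (hq : 0 ≤ q)
    (hGq : ∀ ω ∈ G, q ≤ (posteriorMean α (initialPulls α) fun n => X 0 n ω).real (Iio (μ 1)))
    (k : ℕ) :
    q ^ k * P.real G ≤ P.real (sampleBelow θ (μ 1) (2 * initialPulls α) k ∩ G) := by
  induction k with
  | zero => simp [sampleBelow]
  | succ k ih =>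
    set t := 2 * initialPulls α + k with ht
    set A := sampleBelow θ (μ 1) (2 * initialPulls α) k with hA
    have hle := h.past_le t
    have hAG : MeasurableSet[past X θ J t] (A ∩ G) :=
      (measurableSet_sampleBelow_past _ _ _).inter (hG t)
    have hB : MeasurableSet (θ 0 t ⁻¹' Iio (μ 1)) := h.measurable_sample 0 t measurableSet_Iio
    have hcond := h.sample_zero t (by omega) (Iio (μ 1)) measurableSet_Iio
    have hset : sampleBelow θ (μ 1) (2 * initialPulls α) (k + 1) ∩ G
        = (A ∩ G) ∩ θ 0 t ⁻¹' Iio (μ 1) := by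
      rw [sampleBelow_succ]; exact inter_right_comm _ _ _
    have hint : Integrable ((θ 0 t ⁻¹' Iio (μ 1)).indicator fun _ => (1 : ℝ)) P :=
      (integrable_const 1).indicator hB
    calc q ^ (k + 1) * P.real G = q * (q ^ k * P.real G) := by ring
      _ ≤ q * P.real (A ∩ G) := mul_le_mul_of_nonneg_left ih hq
      _ = ∫ _ in A ∩ G, q ∂P := by rw [setIntegral_const, smul_eq_mul, mul_comm]
      -- `A ∩ G` lies in the past of round `t`, and on it the conditional probability is the frozen
      -- posterior mass, at least `q`.
      _ ≤ ∫ ω in A ∩ G, (P⟦θ 0 t ⁻¹' Iio (μ 1) | past X θ J t⟧) ω ∂P := by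
          refine setIntegral_mono_on_ae (integrableOn_const (by simp))
            integrable_condExp.integrableOn (hle _ hAG) ?_
          filter_upwards [hcond] with ω hω hωm
          rw [hω, h.pullCount_zero_eq hωm.1]
          exact hGq ω hωm.2
      _ = ∫ ω in A ∩ G, (θ 0 t ⁻¹' Iio (μ 1)).indicator (fun _ => (1 : ℝ)) ω ∂P :=
          setIntegral_condExp hle hint hAG
      _ = _ := by
          rw [integral_indicator hB, setIntegral_const, smul_eq_mul, mul_one, hset,
            measureReal_restrict_apply hB, inter_comm]

/-- Initialization rounds are dropped. The index `k + 1` is needed because only then does the event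
include the sample of round `2 * initialPulls α + k` itself, which forces arm `1`. -/
lemma expectedRegret_ge [IsProbabilityMeasure P]
    (h : IsThompsonKnownArm P α μ σ X θ J) (K : ℕ) :
    gap μ 1 * ∑ k ∈ Finset.range K,
      P.real (sampleBelow θ (μ 1) (2 * initialPulls α) (k + 1))
      ≤ expectedRegret P μ J (2 * initialPulls α + K) := by
  have hmeas (t : ℕ) : Measurable fun ω => gap μ (J t ω) :=
    (measurable_of_finite (gap μ)).comp (h.measurable_arm t)
  have hint (t : ℕ) : Integrable (fun ω => gap μ (J t ω)) P := by
    refine Integrable.of_bound (hmeas t).aestronglyMeasurable (gap μ 0 + gap μ 1)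
      (Eventually.of_forall fun ω => ?_)
    rw [Real.norm_of_nonneg (gap_nonneg μ _)]
    have h0 := gap_nonneg μ 0
    have h1 := gap_nonneg μ 1
    rcases (show J t ω = 0 ∨ J t ω = 1 by omega) with hJ | hJ <;> rw [hJ] <;> linarith
  unfold expectedRegret regret
  rw [integral_finsetSum _ fun t _ => hint t, Finset.sum_range_add, Finset.mul_sum]
  refine le_add_of_nonneg_of_le (Finset.sum_nonneg fun t _ =>
    integral_nonneg fun ω => gap_nonneg μ _) (Finset.sum_le_sum fun k _ => ?_)
  have hS : MeasurableSet (sampleBelow θ (μ 1) (2 * initialPulls α) (k + 1)) :=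
    h.past_le _ _ (measurableSet_sampleBelow_past (X := X) (J := J) _ _ _)
  rw [mul_comm, ← smul_eq_mul, ← integral_indicator_const _ hS]
  refine integral_mono ((integrable_const _).indicator hS) (hint _) fun ω => ?_
  refine indicator_apply_le' (fun hω => ?_) fun _ => gap_nonneg μ _
  rw [sampleBelow_succ] at hω
  rw [h.arm_eq_one (Nat.le_add_right _ _) hω.2]

end IsThompsonKnownArm

end NormalBandit

namespace NormalBandit

/-! ### Samples that are concentrated on a short interval -/

/-- The density is continuous and positive, so its minimum over `[a, a + 1]` serves all subintervals
at once. -/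
lemma exists_le_gaussianReal_Ico (m a : ℝ) {v : NNReal} (hv : v ≠ 0) :
    ∃ c : ℝ, 0 < c ∧ ∀ s t : ℝ, a ≤ s → s ≤ t → t ≤ a + 1 →
      c * (t - s) ≤ (gaussianReal m v).real (Ico s t) := by
  have hcont : Continuous (gaussianPDFReal m v) := by
    unfold gaussianPDFReal; fun_prop
  obtain ⟨z, -, hz⟩ := isCompact_Icc.exists_isMinOn (nonempty_Icc.2 (by linarith : a ≤ a + 1))
    hcont.continuousOn
  refine ⟨gaussianPDFReal m v z, gaussianPDFReal_pos _ _ _ hv, fun s t hs hst ht => ?_⟩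
  have hint := integrable_gaussianPDFReal m v
  rw [measureReal_def, gaussianReal_apply_eq_integral _ hv,
    ENNReal.toReal_ofReal (integral_nonneg fun x => gaussianPDFReal_nonneg _ _ _)]
  calc gaussianPDFReal m v z * (t - s) = ∫ _ in Ico s t, gaussianPDFReal m v z := by
        rw [setIntegral_const, smul_eq_mul, measureReal_def, Real.volume_Ico,
          ENNReal.toReal_ofReal (by linarith), mul_comm]
    _ ≤ _ := setIntegral_mono_on (integrableOn_const (by simp)) hint.integrableOn
        measurableSet_Ico fun x hx => hz ⟨hs.trans hx.1, hx.2.le.trans ht⟩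

/-- The first half of the interval `[a + j / M, a + (j + 1) / M)` for `k = 0`, and its second half
otherwise. -/
noncomputable def cell (a : ℝ) (M j k : ℕ) : Set ℝ :=
  if k = 0 then Ico (a + j / M) (a + j / M + 1 / (2 * M))
  else Ico (a + j / M + 1 / (2 * M)) (a + (j + 1) / M)

lemma measurableSet_cell (a : ℝ) (M j k : ℕ) : MeasurableSet (cell a M j k) := by
  unfold cell; split_ifs <;> exact measurableSet_Ico

lemma cell_subset {a : ℝ} {M : ℕ} (hM : 0 < M) (j k : ℕ) :
    cell a M j k ⊆ Ico (a + j / M) (a + (j + 1) / M) := by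
  have hM' : (0 : ℝ) < M := by exact_mod_cast hM
  have h1 : (0 : ℝ) < 1 / (2 * M) := by positivity
  have h2 : (j + 1 : ℝ) / M = j / M + (1 / (2 * M) + 1 / (2 * M)) := by field_simp; ring
  unfold cell
  split_ifs
  · exact Ico_subset_Ico_right (by linarith)
  · exact Ico_subset_Ico_left (by linarith)

variable {Ω : Type u} {X θ : Fin 2 → ℕ → Ω → ℝ} {J : ℕ → Ω → Fin 2}

/-- The event that the first `n` rewards of the arm `0` are in the cells with index `j`. -/
def rewardsInCell (X : Fin 2 → ℕ → Ω → ℝ) (n : ℕ) (a : ℝ) (M j : ℕ) : Set Ω :=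
  ⋂ k ∈ Finset.range n, X 0 k ⁻¹' cell a M j k

/-- Reward `0` alone separates different indices `j`. -/
lemma pairwiseDisjoint_rewardsInCell {n : ℕ} (hn : 0 < n) (a : ℝ) {M : ℕ} (hM : 0 < M)
    (s : Set ℕ) : s.PairwiseDisjoint (rewardsInCell X n a M) := by
  have hM' : (0 : ℝ) < M := by exact_mod_cast hM
  have hlt {i j : ℕ} (hij : i < j) :
      Disjoint (rewardsInCell X n a M i) (rewardsInCell X n a M j) := by
    refine disjoint_left.2 fun ω hi hj => ?_
    have hi := (cell_subset hM _ _ (show X 0 0 ω ∈ cell a M i 0 from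
      mem_iInter₂.1 hi 0 (Finset.mem_range.2 hn))).2
    have hj := (cell_subset hM _ _ (show X 0 0 ω ∈ cell a M j 0 from
      mem_iInter₂.1 hj 0 (Finset.mem_range.2 hn))).1
    have : (i + 1 : ℝ) / M ≤ j / M :=
      div_le_div_of_nonneg_right (by exact_mod_cast hij) hM'.le
    linarith
  intro i _ j _ hij
  rcases lt_or_gt_of_ne hij with h | h
  · exact hlt h
  · exact (hlt h).symm

lemma measurableSet_rewardsInCell_past (n : ℕ) (a : ℝ) (M j t : ℕ) :
    MeasurableSet[past X θ J t] (rewardsInCell X n a M j) :=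
  Finset.measurableSet_biInter _ fun k _ => measurable_reward_past 0 k t (measurableSet_cell a M j k)

namespace IsThompsonKnownArm

variable [mΩ : MeasurableSpace Ω] {P : Measure Ω} {α : ℝ} {μ σ : Fin 2 → ℝ}

/-- Each of the `n` independent rewards must hit a half cell of length `1 / (2 * M)`. The Gaussian
bound is a hypothesis so that `c` can be fixed before `σ₂` and the probability space. -/
lemma measureReal_rewardsInCell_ge [IsProbabilityMeasure P]
    (h : IsThompsonKnownArm P α μ σ X θ J) {a c : ℝ} (hc : 0 < c)
    (hgauss : ∀ s t : ℝ, a ≤ s → s ≤ t → t ≤ a + 1 →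
      c * (t - s) ≤ (gaussianReal (μ 0) (σ 0 ^ 2).toNNReal).real (Ico s t))
    (n : ℕ) {M j : ℕ} (hj : j < M) :
    (c / (2 * M)) ^ n ≤ P.real (rewardsInCell X n a M j) := by
  have hM : (0 : ℝ) < M := by exact_mod_cast (Nat.zero_le j).trans_lt hj
  have hind : iIndepFun (fun k => X 0 k) P :=
    h.indep_reward.precomp (g := fun k : ℕ => ((0 : Fin 2), k)) fun _ _ hkl => (Prod.ext_iff.1 hkl).2
  rw [measureReal_def, rewardsInCell,
    hind.measure_inter_preimage_eq_mul _ fun k _ => measurableSet_cell a M j k, ENNReal.toReal_prod]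
  conv_lhs => rw [← Finset.card_range n, ← Finset.prod_const]
  refine Finset.prod_le_prod (fun _ _ => by positivity) fun k _ => ?_
  rw [← Measure.map_apply (h.measurable_reward 0 k) (measurableSet_cell a M j k), h.law_reward,
    ← measureReal_def]
  have h0 : (0 : ℝ) ≤ j / M := by positivity
  have h1 : (0 : ℝ) < 1 / (2 * M) := by positivity
  have h2 : (j + 1 : ℝ) / M = j / M + (1 / (2 * M) + 1 / (2 * M)) := by field_simp; ring
  have h3 : (j + 1 : ℝ) / M ≤ 1 := (div_le_one hM).2 (by exact_mod_cast hj)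
  have h4 : c / (2 * M) = c * (1 / (2 * M)) := by ring
  unfold cell
  split_ifs
  · refine le_trans (le_of_eq ?_) (hgauss _ _ ?_ ?_ ?_)
    · rw [h4]; ring
    all_goals linarith
  · refine le_trans (le_of_eq ?_) (hgauss _ _ ?_ ?_ ?_)
    · rw [h4, h2]; ring
    all_goals linarith

lemma two_le_initialPulls (α : ℝ) : 2 ≤ initialPulls α := by
  unfold initialPulls
  have : (2 : ℤ) ≤ max 2 (3 - ⌈2 * α⌉) := le_max_left _ _
  omega

/-- The interval `[μ 1 - 2, μ 1 - 1)` is cut into `M` pieces. The `M` disjoint events, each of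
probability at least `(c / (2 * M)) ^ n`, together yield `(c / 2) ^ n * (1 / M) ^ (n - 1)`: the
union gains one factor `M`. -/
lemma measureReal_sampleBelow_ge_of_mesh [IsProbabilityMeasure P] (hα : 0 ≤ α)
    (h : IsThompsonKnownArm P α μ σ X θ J) {c : ℝ} (hc : 0 < c)
    (hgauss : ∀ s t : ℝ, μ 1 - 2 ≤ s → s ≤ t → t ≤ μ 1 - 2 + 1 →
      c * (t - s) ≤ (gaussianReal (μ 0) (σ 0 ^ 2).toNNReal).real (Ico s t))
    {M : ℕ} (hM : 0 < M) {q : ℝ} (hq : 0 ≤ q)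
    (hqM : q ≤ 1 - (1 / M : ℝ) ^ ((initialPulls α : ℝ) - 1 + 2 * α)
      / ((initialPulls α : ℝ) - 1 + 2 * α)) (k : ℕ) :
    q ^ k * ((c / 2) ^ initialPulls α * (1 / M : ℝ) ^ (initialPulls α - 1))
      ≤ P.real (sampleBelow θ (μ 1) (2 * initialPulls α) k) := by
  set n := initialPulls α with hn
  have hn2 : 2 ≤ n := two_le_initialPulls α
  have hM' : (0 : ℝ) < M := by exact_mod_cast hM
  set G : Set Ω := ⋃ j ∈ Finset.range M, rewardsInCell X n (μ 1 - 2) M j with hG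
  have hGmeas (t : ℕ) : MeasurableSet[past X θ J t] G :=
    Finset.measurableSet_biUnion _ fun j _ => measurableSet_rewardsInCell_past _ _ _ _ _
  have hGP : (c / 2) ^ n * (1 / M : ℝ) ^ (n - 1) ≤ P.real G := by
    rw [hG, measureReal_biUnion_finset (pairwiseDisjoint_rewardsInCell (by omega) _ hM _)
      fun j _ => h.past_le 0 _ (measurableSet_rewardsInCell_past _ _ _ _ _)]
    have := Finset.card_nsmul_le_sum (Finset.range M)
      (fun j => P.real (rewardsInCell X n (μ 1 - 2) M j)) ((c / (2 * M)) ^ n)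
      fun j hj => h.measureReal_rewardsInCell_ge hc hgauss n (Finset.mem_range.1 hj)
    refine le_trans (le_of_eq ?_) this
    rw [Finset.card_range, nsmul_eq_mul]
    obtain ⟨r, hr⟩ : ∃ r, n = r + 1 := ⟨n - 1, by omega⟩
    rw [hr, Nat.add_sub_cancel, show c / (2 * M) = c / 2 * (1 / M) by field_simp, mul_pow,
      pow_succ (1 / M : ℝ)]
    field_simp
  have hpost : ∀ ω ∈ G, q ≤ (posteriorMean α n fun k => X 0 k ω).real (Iio (μ 1)) := by
    intro ω hω
    obtain ⟨j, hj, hωj⟩ := mem_iUnion₂.1 hω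
    have hj : j < M := Finset.mem_range.1 hj
    have hcell (k : ℕ) (hk : k < n) : X 0 k ω ∈ cell (μ 1 - 2) M j k :=
      mem_iInter₂.1 hωj k (Finset.mem_range.2 hk)
    have hj1 : (j + 1 : ℝ) / M ≤ 1 := (div_le_one hM').2 (by exact_mod_cast hj)
    refine hqM.trans (posteriorMean_Iio_ge hn2 hα (x := fun k => X 0 k ω) ?_
      (b := μ 1 - 2 + j / M) (by positivity) (fun k hk => ?_) ?_)
    -- The purpose of the half cells: reward `0` in the first half and reward `1` in the second give
    -- `x 0 < x 1` everywhere on the event.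
    · have h0 := hcell 0 (by omega)
      have h1 := hcell 1 (by omega)
      rw [cell, if_pos rfl] at h0
      rw [cell, if_neg one_ne_zero] at h1
      exact h0.2.trans_le h1.1
    · have := cell_subset hM _ _ (hcell k hk)
      rw [add_div, ← add_assoc] at this
      exact ⟨this.1, this.2.le⟩
    · rw [add_div] at hj1
      linarith
  calc q ^ k * ((c / 2) ^ n * (1 / M : ℝ) ^ (n - 1)) ≤ q ^ k * P.real G :=
        mul_le_mul_of_nonneg_left hGP (pow_nonneg hq k)
    _ ≤ _ := h.measureReal_sampleBelow_inter_ge hGmeas hq hpost k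
    _ ≤ _ := measureReal_mono inter_subset_left

end IsThompsonKnownArm

/-- The exponent of the decay of the probability that only the known arm is pulled. -/
noncomputable def decayExponent (α : ℝ) : ℝ :=
  ((initialPulls α : ℝ) - 1) / ((initialPulls α : ℝ) - 1 + 2 * α)

lemma one_le_initialPulls_sub_one (α : ℝ) : (1 : ℝ) ≤ (initialPulls α : ℝ) - 1 := by
  have : (2 : ℝ) ≤ initialPulls α := by
    exact_mod_cast IsThompsonKnownArm.two_le_initialPulls α
  linarith

lemma decayExponent_nonneg {α : ℝ} (hα : 0 ≤ α) : 0 ≤ decayExponent α := by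
  have := one_le_initialPulls_sub_one α
  unfold decayExponent
  exact div_nonneg (by linarith) (by linarith)

lemma decayExponent_le_one {α : ℝ} (hα : 0 ≤ α) : decayExponent α ≤ 1 := by
  have := one_le_initialPulls_sub_one α
  exact (div_le_one (by linarith)).2 (by linarith)

lemma decayExponent_lt_one {α : ℝ} (hα : 0 < α) : decayExponent α < 1 := by
  have := one_le_initialPulls_sub_one α
  exact (div_lt_one (by linarith)).2 (by linarith)

/-! ### The mesh adapted to the number of rounds. -/

lemma exists_le_measureReal_sampleBelow {α : ℝ} (hα : 0 ≤ α) (μ₁ μ₂ : ℝ) {σ₁ : ℝ} (hσ₁ : 0 < σ₁) :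
    ∃ c : ℝ, 0 < c ∧ ∀ (σ₂ : ℝ) (Ω : Type u) [MeasurableSpace Ω] (P : Measure Ω)
      [IsProbabilityMeasure P] (X θ : Fin 2 → ℕ → Ω → ℝ) (J : ℕ → Ω → Fin 2),
      IsThompsonKnownArm P α ![μ₁, μ₂] ![σ₁, σ₂] X θ J → ∀ k : ℕ, 0 < k →
        c * (k : ℝ) ^ (-decayExponent α)
          ≤ P.real (sampleBelow θ μ₂ (2 * initialPulls α) k) := by
  have hv : (σ₁ ^ 2).toNNReal ≠ 0 := by
    rw [Ne, Real.toNNReal_eq_zero, not_le]; positivity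
  obtain ⟨c, hc, hgauss⟩ := exists_le_gaussianReal_Ico μ₁ (μ₂ - 2) hv
  have hn1 := one_le_initialPulls_sub_one α
  set n := initialPulls α with hn
  set d : ℝ := (n : ℝ) - 1 + 2 * α with hd
  have hd1 : 1 ≤ d := by linarith
  have hd0 : 0 < d := by linarith
  refine ⟨1 / 2 * ((c / 2) ^ n * ((1 / 2) ^ (n - 1) * 2 ^ (-decayExponent α))), by positivity, ?_⟩
  intro σ₂ Ω _ P _ X θ J h k hk
  have hk' : (1 : ℝ) ≤ k := by exact_mod_cast hk
  have hr1 : 1 ≤ (2 * k : ℝ) ^ (1 / d) := Real.one_le_rpow (by linarith) (by positivity)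
  -- The mesh `M = ⌈r⌉₊` makes the posterior tail at most `1 / (2 * k)` per round, small enough to
  -- survive `k` rounds.
  set r : ℝ := (2 * k : ℝ) ^ (1 / d) with hr
  have hMr : r ≤ ⌈r⌉₊ := Nat.le_ceil r
  have hMr' : (⌈r⌉₊ : ℝ) ≤ 2 * r := by
    have := Nat.ceil_lt_add_one (zero_le_one.trans hr1)
    linarith
  set M := ⌈r⌉₊
  have hM0 : (0 : ℝ) < M := by linarith
  have hrd : r ^ d = 2 * k := by
    rw [hr, ← Real.rpow_mul (by positivity), one_div_mul_cancel hd0.ne', Real.rpow_one]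
  have hqM : 1 - 1 / (2 * k : ℝ) ≤ 1 - (1 / M : ℝ) ^ d / d := by
    have h1 : (1 / M : ℝ) ^ d ≤ 1 / (2 * k) := by
      rw [Real.div_rpow zero_le_one hM0.le, Real.one_rpow, ← hrd]
      exact one_div_le_one_div_of_le (by positivity) (Real.rpow_le_rpow (by linarith) hMr hd0.le)
    have h2 : (1 / M : ℝ) ^ d / d ≤ (1 / M : ℝ) ^ d := div_le_self (by positivity) hd1
    linarith
  have hkinv : 1 / (2 * k : ℝ) ≤ 1 / 2 := one_div_le_one_div_of_le (by norm_num) (by linarith)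
  -- Bernoulli's inequality: `1 - k / (2 * k) = 1 / 2`.
  have hpow : (1 / 2 : ℝ) ≤ (1 - 1 / (2 * k : ℝ)) ^ k := by
    have := one_add_mul_le_pow (a := -(1 / (2 * k : ℝ))) (by linarith) k
    rw [← sub_eq_add_neg] at this
    refine le_trans (le_of_eq ?_) this
    field_simp; norm_num
  have hkey := h.measureReal_sampleBelow_ge_of_mesh hα hc hgauss (by exact_mod_cast hM0)
    (by linarith) hqM k
  -- Rounding up costs at most a factor 2, `M ≤ 2 * r`, and `(1 / r) ^ (n - 1) = (2 * k) ^
  -- (-decayExponent α)` by the choice of `r`.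
  have hMpow : (1 / 2 : ℝ) ^ (n - 1) * (2 ^ (-decayExponent α) * (k : ℝ) ^ (-decayExponent α))
      ≤ (1 / M : ℝ) ^ (n - 1) := by
    have hexp : (2 : ℝ) ^ (-decayExponent α) * (k : ℝ) ^ (-decayExponent α)
        = (1 / r) ^ (n - 1) := by
      have hcast : ((n - 1 : ℕ) : ℝ) = (n : ℝ) - 1 := by
        rw [Nat.cast_sub (by have := IsThompsonKnownArm.two_le_initialPulls α; omega), Nat.cast_one]
      rw [← Real.mul_rpow (by norm_num) (by positivity), one_div, inv_pow, ← Real.rpow_natCast,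
        hcast, hr, ← Real.rpow_mul (by positivity), ← Real.rpow_neg (by positivity)]
      congr 2
      rw [decayExponent]; ring
    rw [hexp, ← mul_pow, one_div_mul_one_div]
    exact pow_le_pow_left₀ (by positivity) (one_div_le_one_div_of_le hM0 hMr') _
  refine le_trans ?_ hkey
  calc _ = 1 / 2 * ((c / 2) ^ n *
        ((1 / 2 : ℝ) ^ (n - 1) * (2 ^ (-decayExponent α) * (k : ℝ) ^ (-decayExponent α)))) := by
        ring
    _ ≤ _ := mul_le_mul hpow (mul_le_mul_of_nonneg_left hMpow (by positivity)) (by positivity)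
        (by positivity)

/-! ### Lower bounds for the regret -/

lemma le_gap_one (μ₁ μ₂ : ℝ) : μ₁ - μ₂ ≤ gap ![μ₁, μ₂] 1 :=
  sub_le_sub_right (le_ciSup (Set.finite_range ![μ₁, μ₂]).bddAbove 0) _

lemma exists_le_expectedRegret {α : ℝ} (hα : 0 ≤ α) {μ₁ μ₂ σ₁ : ℝ} (hμ : μ₂ < μ₁)
    (hσ₁ : 0 < σ₁) :
    ∃ c : ℝ, 0 < c ∧ ∀ (σ₂ : ℝ) (Ω : Type u) [MeasurableSpace Ω] (P : Measure Ω)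
      [IsProbabilityMeasure P] (X θ : Fin 2 → ℕ → Ω → ℝ) (J : ℕ → Ω → Fin 2),
      IsThompsonKnownArm P α ![μ₁, μ₂] ![σ₁, σ₂] X θ J → ∀ K : ℕ,
        c * ∑ k ∈ Finset.range K, ((k + 1 : ℕ) : ℝ) ^ (-decayExponent α)
          ≤ expectedRegret P ![μ₁, μ₂] J (2 * initialPulls α + K) := by
  obtain ⟨c, hc, hP⟩ := exists_le_measureReal_sampleBelow hα μ₁ μ₂ hσ₁
  refine ⟨(μ₁ - μ₂) * c, mul_pos (sub_pos.2 hμ) hc, fun σ₂ Ω _ P _ X θ J h K => ?_⟩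
  refine le_trans ?_ (h.expectedRegret_ge K)
  rw [mul_assoc, Finset.mul_sum]
  refine mul_le_mul (le_gap_one μ₁ μ₂)
    (Finset.sum_le_sum fun k _ => hP σ₂ Ω P X θ J h (k + 1) k.succ_pos)
    (Finset.sum_nonneg fun k _ => by positivity) (gap_nonneg _ _)

lemma log_le_sum_rpow_neg {γ : ℝ} (hγ : γ ≤ 1) (K : ℕ) :
    Real.log ((K + 1 : ℕ) : ℝ) ≤ ∑ k ∈ Finset.range K, ((k + 1 : ℕ) : ℝ) ^ (-γ) := by
  refine (log_add_one_le_harmonic K).trans ?_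
  rw [harmonic]
  push_cast
  refine Finset.sum_le_sum fun k _ => ?_
  rw [← Real.rpow_neg_one]
  exact Real.rpow_le_rpow_of_exponent_le (by linarith [k.cast_nonneg (α := ℝ)]) (by linarith)

/-- Each of the `K` terms is at least the last one, `K ^ (-γ)`. -/
lemma rpow_le_sum_rpow_neg {γ : ℝ} (hγ : 0 ≤ γ) {K : ℕ} (hK : 0 < K) :
    (K : ℝ) ^ (1 - γ) ≤ ∑ k ∈ Finset.range K, ((k + 1 : ℕ) : ℝ) ^ (-γ) := by
  have hK' : (0 : ℝ) < K := by exact_mod_cast hK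
  rw [sub_eq_add_neg, Real.rpow_add hK', Real.rpow_one, ← nsmul_eq_mul]
  conv_lhs => rw [← Finset.card_range K]
  refine Finset.card_nsmul_le_sum _ _ _ fun k hk => ?_
  rw [Finset.card_range]
  exact Real.rpow_le_rpow_of_nonpos (by positivity)
    (by exact_mod_cast Finset.mem_range.1 hk) (by linarith)

lemma exists_log_le_expectedRegret {α : ℝ} (hα : 0 ≤ α) {μ₁ μ₂ σ₁ : ℝ} (hμ : μ₂ < μ₁)
    (hσ₁ : 0 < σ₁) :
    ∃ ξ : ℝ, 0 < ξ ∧ ∀ (σ₂ : ℝ) (Ω : Type u) [MeasurableSpace Ω] (P : Measure Ω)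
      [IsProbabilityMeasure P] (X θ : Fin 2 → ℕ → Ω → ℝ) (J : ℕ → Ω → Fin 2),
      IsThompsonKnownArm P α ![μ₁, μ₂] ![σ₁, σ₂] X θ J →
        (ξ : EReal) ≤ liminf (fun T : ℕ =>
          ((expectedRegret P ![μ₁, μ₂] J T / Real.log T : ℝ) : EReal)) atTop := by
  obtain ⟨c, hc, hreg⟩ := exists_le_expectedRegret hα hμ hσ₁
  refine ⟨c / 2, by positivity, fun σ₂ Ω _ P _ X θ J h => le_liminf_of_le (by isBoundedDefault) ?_⟩
  filter_upwards [eventually_ge_atTop (4 * initialPulls α)] with T hT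
  have hn := IsThompsonKnownArm.two_le_initialPulls α
  obtain ⟨K, rfl⟩ : ∃ K, T = 2 * initialPulls α + K := ⟨T - 2 * initialPulls α, by omega⟩
  have hmain := hreg σ₂ Ω P X θ J h K
  have hlog := log_le_sum_rpow_neg (decayExponent_le_one hα) K
  set T := 2 * initialPulls α + K
  have hT1 : (1 : ℝ) < T := by exact_mod_cast (by omega : 1 < T)
  -- From `T ≥ 4 * initialPulls α` one has `T ≤ 2 * K`. The square gives `log T ≤ 2 * log (K + 1)`,
  -- whence the constant `c / 2`.
  have hTK : (T : ℝ) ≤ ((K + 1 : ℕ) : ℝ) ^ 2 := by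
    exact_mod_cast (show T ≤ (K + 1) ^ 2 by nlinarith [show T ≤ 2 * K by omega])
  have hlogT := Real.log_le_log (by linarith) hTK
  rw [Real.log_pow] at hlogT
  push_cast at hlogT hlog
  rw [EReal.coe_le_coe_iff, le_div_iff₀ (Real.log_pos hT1)]
  calc c / 2 * Real.log T ≤ c * Real.log (K + 1) := by nlinarith
    _ ≤ _ := (mul_le_mul_of_nonneg_left (by simpa using hlog) hc.le).trans hmain

lemma exists_rpow_le_expectedRegret {α : ℝ} (hα : 0 < α) {μ₁ μ₂ σ₁ : ℝ} (hμ : μ₂ < μ₁)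
    (hσ₁ : 0 < σ₁) :
    ∃ ξ : ℝ, 0 < ξ ∧ ∃ η : ℝ, 0 < η ∧ ∀ (σ₂ : ℝ) (Ω : Type u) [MeasurableSpace Ω] (P : Measure Ω)
      [IsProbabilityMeasure P] (X θ : Fin 2 → ℕ → Ω → ℝ) (J : ℕ → Ω → Fin 2),
      IsThompsonKnownArm P α ![μ₁, μ₂] ![σ₁, σ₂] X θ J →
        (ξ : EReal) ≤ liminf (fun T : ℕ =>
          ((expectedRegret P ![μ₁, μ₂] J T / (T : ℝ) ^ η : ℝ) : EReal)) atTop := by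
  obtain ⟨c, hc, hreg⟩ := exists_le_expectedRegret hα.le hμ hσ₁
  have hη : 0 < 1 - decayExponent α := sub_pos.2 (decayExponent_lt_one hα)
  -- The power of `1 / 2` pays for replacing `K` by `T / 2`, as `T ≤ 2 * K` eventually.
  refine ⟨c * (1 / 2) ^ (1 - decayExponent α), by positivity, 1 - decayExponent α, hη,
    fun σ₂ Ω _ P _ X θ J h => le_liminf_of_le (by isBoundedDefault) ?_⟩
  filter_upwards [eventually_ge_atTop (4 * initialPulls α)] with T hT
  have hn := IsThompsonKnownArm.two_le_initialPulls α
  obtain ⟨K, rfl⟩ : ∃ K, T = 2 * initialPulls α + K := ⟨T - 2 * initialPulls α, by omega⟩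
  have hmain := hreg σ₂ Ω P X θ J h K
  have hpow := rpow_le_sum_rpow_neg (decayExponent_nonneg hα.le) (show 0 < K by omega)
  set T := 2 * initialPulls α + K
  have hT0 : (0 : ℝ) < T := by exact_mod_cast (by omega : 0 < T)
  have hTK : (T : ℝ) ≤ 2 * K := by exact_mod_cast (by omega : T ≤ 2 * K)
  rw [EReal.coe_le_coe_iff, le_div_iff₀ (by positivity), mul_assoc,
    ← Real.mul_rpow (by norm_num) hT0.le]
  refine le_trans (mul_le_mul_of_nonneg_left (le_trans ?_ hpow) hc.le) hmain
  exact Real.rpow_le_rpow (by positivity) (by linarith) hη.le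

lemma exists_div_Dinf_lt {Δ ξ : ℝ} (hΔ : 0 < Δ) (hξ : 0 < ξ) :
    ∃ s : ℝ, 0 < s ∧ ∀ σ : ℝ, 0 < σ → σ < s → Δ / Dinf Δ (σ ^ 2) < ξ := by
  -- `Dinf Δ (σ ^ 2)` exceeds `log (Δ / σ)`, and this threshold is where `log (Δ / σ)` equals `Δ /
  -- ξ`.
  refine ⟨Δ * Real.exp (-(Δ / ξ)), by positivity, fun σ hσ hσs => ?_⟩
  have h1 : Real.exp (Δ / ξ) < Δ / σ := by
    rw [lt_div_iff₀ hσ]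
    calc Real.exp (Δ / ξ) * σ < Real.exp (Δ / ξ) * (Δ * Real.exp (-(Δ / ξ))) := by gcongr
      _ = Δ := by rw [Real.exp_neg]; field_simp
  have h2 : Δ / ξ < Dinf Δ (σ ^ 2) := by
    have h3 : Real.exp (Δ / ξ) ^ 2 < 1 + Δ ^ 2 / σ ^ 2 := by
      rw [← div_pow]
      nlinarith [pow_lt_pow_left₀ h1 (Real.exp_pos _).le two_ne_zero]
    have h4 := Real.log_lt_log (by positivity) h3
    rw [Real.log_pow, Real.log_exp] at h4
    push_cast at h4
    unfold Dinf
    linarith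
  have h5 : 0 < Δ / ξ := by positivity
  rw [div_lt_iff₀ (h5.trans h2), ← div_lt_iff₀' hξ]
  exact h2

end NormalBandit

theorem theorem2 (α : ℝ) (hα : 0 ≤ α) (μ₁ μ₂ σ₁ : ℝ) (hμ : μ₂ < μ₁) (hσ₁ : 0 < σ₁) :
    -- at least logarithmic regret, with a constant that does not depend on `σ₂`
    (∃ ξ : ℝ, 0 < ξ ∧ ∀ σ₂ : ℝ, 0 < σ₂ →
      ∀ (Ω : Type u) [MeasurableSpace Ω] (P : Measure Ω) [IsProbabilityMeasure P]
        (X θ : Fin 2 → ℕ → Ω → ℝ) (J : ℕ → Ω → Fin 2),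
        NormalBandit.IsThompsonKnownArm P α ![μ₁, μ₂] ![σ₁, σ₂] X θ J →
        (ξ : EReal) ≤ liminf (fun T : ℕ =>
          ((NormalBandit.expectedRegret P ![μ₁, μ₂] J T / Real.log T : ℝ) : EReal)) atTop) ∧
    -- the asymptotic bound is exceeded when `σ₂` is small
    (∃ s : ℝ, 0 < s ∧ ∀ σ₂ : ℝ, 0 < σ₂ → σ₂ < s →
      ∀ (Ω : Type u) [MeasurableSpace Ω] (P : Measure Ω) [IsProbabilityMeasure P]
        (X θ : Fin 2 → ℕ → Ω → ℝ) (J : ℕ → Ω → Fin 2),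
        NormalBandit.IsThompsonKnownArm P α ![μ₁, μ₂] ![σ₁, σ₂] X θ J →
        (((μ₁ - μ₂) / NormalBandit.Dinf (μ₁ - μ₂) (σ₂ ^ 2) : ℝ) : EReal) <
          liminf (fun T : ℕ =>
            ((NormalBandit.expectedRegret P ![μ₁, μ₂] J T / Real.log T : ℝ) : EReal)) atTop) ∧
    -- polynomial regret if `α > 0`
    (0 < α → ∃ ξ' : ℝ, 0 < ξ' ∧ ∃ η : ℝ, 0 < η ∧ ∀ σ₂ : ℝ, 0 < σ₂ →
      ∀ (Ω : Type u) [MeasurableSpace Ω] (P : Measure Ω) [IsProbabilityMeasure P]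
        (X θ : Fin 2 → ℕ → Ω → ℝ) (J : ℕ → Ω → Fin 2),
        NormalBandit.IsThompsonKnownArm P α ![μ₁, μ₂] ![σ₁, σ₂] X θ J →
        (ξ' : EReal) ≤ liminf (fun T : ℕ =>
          ((NormalBandit.expectedRegret P ![μ₁, μ₂] J T / (T : ℝ) ^ η : ℝ) : EReal)) atTop) := by
  obtain ⟨ξ, hξ, hlog⟩ := NormalBandit.exists_log_le_expectedRegret.{u} hα hμ hσ₁
  obtain ⟨s, hs, hDinf⟩ := NormalBandit.exists_div_Dinf_lt (sub_pos.2 hμ) hξ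
  refine ⟨⟨ξ, hξ, fun σ₂ _ => hlog σ₂⟩, ⟨s, hs, fun σ₂ hσ₂ hσ₂s Ω _ P _ X θ J h => ?_⟩,
    fun hα => ?_⟩
  · exact (EReal.coe_lt_coe_iff.2 (hDinf σ₂ hσ₂ hσ₂s)).trans_le (hlog σ₂ Ω P X θ J h)
  · obtain ⟨ξ', hξ', η, hη, hpow⟩ := NormalBandit.exists_rpow_le_expectedRegret.{u} hα hμ hσ₁
    exact ⟨ξ', hξ', η, hη, fun σ₂ _ => hpow σ₂⟩
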